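/- Let $V$ be a smooth finite-dimensional manifold without boundary, Hausdorff and $\sigma$-compact (for example a closed manifold), let $a\in H^2(V;\mathbb{Z})$, and let $q_1,q_2\in\mathbb{Z}$. Put $q_0=\gcd(q_1,q_2)$, with $\gcd(0,0)=0$. Let $P_q\to V$ be a smooth principal $S^1\times S^1$-bundle with characteristic classes $(q_1a,q_2a)$, and let $P_{q_0}\to V$ be a smooth principal $S^1$-bundle with Euler class $q_0a$. Then the total space of $P_q$ is diffeomorphic to $P_{q_0}\times S^1$. Here the Euler class of a smooth principal $S^1$-bundle is the image in the Čech cohomology group $H^2(V;\mathbb{Z})$ of the class of its transition functions under the connecting homomorphism of the exponential sequence $0\to\mathbb{Z}\to\mathbb{R}\to S^1\to 0$: if the transition functions are $g_{ij}=e^{2\pi i\theta_{ij}}$ with $\theta_{ij}$ continuous and real-valued, it is represented by the integral cocycle $\theta_{ij}+\theta_{jk}-\theta_{ik}$. The two characteristic classes of a principal $S^1\times S^1$-bundle are obtained in the same way from the two components of its transition functions; that is, they are the Euler classes of the two circle bundles of which it is the fibre product over $V$. -/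

import Mathlib

open Set
open scoped Manifold ContDiff

/-! ### Čech cohomology in degree two with integer coefficients

Čech cohomology is the direct limit, over the open covers of `X`, of the cohomology of the complexes
of (not necessarily alternating) cochains with values in the constant sheaf `ℤ`. We take the limit
over the cofinal family of covers `(U x)` indexed by the points of `X` with `x ∈ U x`. These are
directed by pointwise inclusion, with the identity of the index set as the refinement map, so the
limit can be written down by hand. A `ℤ`-valued `n`-cochain on `U` assigns to `x₀, …, xₙ` a
continuous (i.e. locally constant) integer-valued function on `U x₀ ∩ … ∩ U xₙ`. It is stored as a
function on all of `X`, whose values outside that intersection are irrelevant. -/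

/-- An open cover of `X` indexed by the points of `X`, with `x ∈ U x` for every `x`. -/
def IsPointedCover {X : Type*} [TopologicalSpace X] (U : X → Set X) : Prop :=
  ∀ x, IsOpen (U x) ∧ x ∈ U x

/-- On the cover `U`, the family `c` is a Čech 2-cocycle with values in the constant sheaf `ℤ`. -/
structure IsCechTwoCocycleOn {X : Type*} [TopologicalSpace X] (U : X → Set X)
    (c : X → X → X → X → ℤ) : Prop where
  continuousOn : ∀ x y z, ContinuousOn (c x y z) (U x ∩ U y ∩ U z)
  cocycle : ∀ w x y z, ∀ b ∈ U w ∩ U x ∩ U y ∩ U z,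
    c x y z b - c w y z b + c w x z b - c w x y b = 0

/-- On the cover `U`, the family `c` is the Čech coboundary of a 1-cochain `m` with values in the
constant sheaf `ℤ`. -/
def IsCechTwoCoboundaryOn {X : Type*} [TopologicalSpace X] (U : X → Set X)
    (c : X → X → X → X → ℤ) : Prop :=
  ∃ m : X → X → X → ℤ, (∀ x y, ContinuousOn (m x y) (U x ∩ U y)) ∧
    ∀ x y z, ∀ b ∈ U x ∩ U y ∩ U z, c x y z b = m y z b - m x z b + m x y b

theorem IsPointedCover.inter {X : Type*} [TopologicalSpace X] {U U' : X → Set X}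
    (h : IsPointedCover U) (h' : IsPointedCover U') : IsPointedCover (fun x => U x ∩ U' x) :=
  fun x => ⟨(h x).1.inter (h' x).1, (h x).2, (h' x).2⟩

theorem isPointedCover_univ (X : Type*) [TopologicalSpace X] :
    IsPointedCover (fun _ : X => (univ : Set X)) :=
  fun x => ⟨isOpen_univ, mem_univ x⟩

/-- Čech 2-cocycles, each on some cover. -/
def cechTwoCocycles (X : Type*) [TopologicalSpace X] : AddSubgroup (X → X → X → X → ℤ) where
  carrier := {c | ∃ U, IsPointedCover U ∧ IsCechTwoCocycleOn U c}
  zero_mem' := ⟨fun _ => univ, isPointedCover_univ X,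
    ⟨fun _ _ _ => continuousOn_const, fun _ _ _ _ _ _ => by simp⟩⟩
  add_mem' := by
    rintro c d ⟨U, hU, hc⟩ ⟨U', hU', hd⟩
    refine ⟨fun x => U x ∩ U' x, hU.inter hU', ⟨fun x y z => ?_, fun w x y z b hb => ?_⟩⟩
    · exact ((hc.continuousOn x y z).mono (by intro b hb; simp_all)).add
        ((hd.continuousOn x y z).mono (by intro b hb; simp_all))
    · have h1 := hc.cocycle w x y z b (by simp_all)
      have h2 := hd.cocycle w x y z b (by simp_all)
      simp only [Pi.add_apply]
      linarith
  neg_mem' := by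
    rintro c ⟨U, hU, hc⟩
    refine ⟨U, hU, ⟨fun x y z => (hc.continuousOn x y z).neg, fun w x y z b hb => ?_⟩⟩
    have h1 := hc.cocycle w x y z b hb
    simp only [Pi.neg_apply]
    linarith

/-- Families that are a Čech 2-coboundary on some cover. In particular, two cocycles which agree
on some common refinement differ by such a family. -/
def cechTwoCoboundaries (X : Type*) [TopologicalSpace X] : AddSubgroup (X → X → X → X → ℤ) where
  carrier := {c | ∃ U, IsPointedCover U ∧ IsCechTwoCoboundaryOn U c}
  zero_mem' := ⟨fun _ => univ, isPointedCover_univ X,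
    ⟨0, fun _ _ => continuousOn_const, fun _ _ _ _ _ => by simp⟩⟩
  add_mem' := by
    rintro c d ⟨U, hU, m, hm, hc⟩ ⟨U', hU', n, hn, hd⟩
    refine ⟨fun x => U x ∩ U' x, hU.inter hU', m + n, fun x y => ?_, fun x y z b hb => ?_⟩
    · exact ((hm x y).mono (by intro b hb; simp_all)).add
        ((hn x y).mono (by intro b hb; simp_all))
    · have h1 := hc x y z b (by simp_all)
      have h2 := hd x y z b (by simp_all)
      simp only [Pi.add_apply]
      linarith
  neg_mem' := by
    rintro c ⟨U, hU, m, hm, hc⟩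
    refine ⟨U, hU, -m, fun x y => (hm x y).neg, fun x y z b hb => ?_⟩
    have h1 := hc x y z b hb
    simp only [Pi.neg_apply]
    linarith

/-- The second Čech cohomology group `H²(X; ℤ)` (for a manifold, this is also the singular
cohomology group): cocycles modulo coboundaries, in the limit over all covers. -/
abbrev CechH2 (X : Type*) [TopologicalSpace X] : Type _ :=
  cechTwoCocycles X ⧸ (cechTwoCoboundaries X).addSubgroupOf (cechTwoCocycles X)

/-! ### Smooth principal bundles -/

section PrincipalBundle

variable {E : Type*} [NormedAddCommGroup E] [NormedSpace ℝ E]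
  {H : Type*} [TopologicalSpace H] (I : ModelWithCorners ℝ E H)
  {V : Type*} [TopologicalSpace V] [ChartedSpace H V]
  {EG : Type*} [NormedAddCommGroup EG] [NormedSpace ℝ EG]
  {HG : Type*} [TopologicalSpace HG] (IG : ModelWithCorners ℝ EG HG)
  {G : Type*} [TopologicalSpace G] [ChartedSpace HG G] [CommGroup G]
  {EP : Type*} [NormedAddCommGroup EP] [NormedSpace ℝ EP]
  {HP : Type*} [TopologicalSpace HP] (IP : ModelWithCorners ℝ EP HP)
  {P : Type*} [TopologicalSpace P] [ChartedSpace HP P] [MulAction G P]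

/-- `e` is a `G`-equivariant diffeomorphism `π ⁻¹(U) ≃ U × G` over the open set `U = e.baseSet`. -/
structure IsPrincipalTrivialization {π : P → V} (e : Bundle.Trivialization G π) : Prop where
  contMDiffOn : ContMDiffOn IP (I.prod IG) ∞ e e.source
  contMDiffOn_symm : ContMDiffOn (I.prod IG) IP ∞ e.toOpenPartialHomeomorph.symm e.target
  map_smul : ∀ (g : G), ∀ p ∈ e.source, e (g • p) = ((e p).1, g * (e p).2)

variable (G) in
/-- `π : P → V` is a smooth principal `G`-bundle, for a commutative Lie group `G` (so that left and
right actions are the same thing). -/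
structure IsSmoothPrincipalBundle (π : P → V) : Prop where
  contMDiff_proj : ContMDiff IP I ∞ π
  contMDiff_smul : ContMDiff (IG.prod IP) IP ∞ (fun p : G × P => p.1 • p.2)
  proj_smul : ∀ (g : G) (p : P), π (g • p) = π p
  locally_trivial : ∀ b : V, ∃ e : Bundle.Trivialization G π,
    b ∈ e.baseSet ∧ IsPrincipalTrivialization I IG IP e

/-- The family `e` consists of equivariant local trivializations of `π` over (neighbourhoods of) the
members of the open cover `U`. -/
structure IsPrincipalAtlas {π : P → V} (U : V → Set V) (e : V → Bundle.Trivialization G π) :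
    Prop where
  isPointedCover : IsPointedCover U
  subset_baseSet : ∀ x, U x ⊆ (e x).baseSet
  principal : ∀ x, IsPrincipalTrivialization I IG IP (e x)

end PrincipalBundle

/-- The transition function `g` from the local trivialization `e'` to the local trivialization `e`,
so that `e p = (b, g b * h)` when `e' p = (b, h)`. Only its values on the common base set matter. -/
def transitionFunction {V P G : Type*} [TopologicalSpace V] [TopologicalSpace P]
    [TopologicalSpace G] [Group G] {π : P → V} (e e' : Bundle.Trivialization G π) (b : V) : G :=
  (e (e'.toOpenPartialHomeomorph.symm (b, 1))).2

/-! ### The Euler class and the characteristic classes -/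

/-- `u` is the image in `H²(V; ℤ)` of the circle-valued 1-cocycle `g` on the cover `U` under the
connecting homomorphism of the exponential sequence `0 → ℤ → ℝ → S¹ → 0`: writing
`g x y = exp (2πi θ x y)` with `θ x y` continuous on `U x ∩ U y`, the class `u` is represented by the
integral cocycle `θ x y + θ y z - θ x z`. -/
def IsConnectingClass {V : Type*} [TopologicalSpace V] (U : V → Set V) (g : V → V → V → Circle)
    (u : CechH2 V) : Prop :=
  ∃ (θ : V → V → V → ℝ) (c : cechTwoCocycles V),
    (∀ x y, ContinuousOn (θ x y) (U x ∩ U y)) ∧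
    (∀ x y, ∀ b ∈ U x ∩ U y, g x y b = Circle.exp (2 * Real.pi * θ x y b)) ∧
    (∀ x y z, ∀ b ∈ U x ∩ U y ∩ U z,
      (c.1 x y z b : ℝ) = θ x y b + θ y z b - θ x z b) ∧
    u = (c : CechH2 V)

section CharacteristicClasses

variable {E : Type*} [NormedAddCommGroup E] [NormedSpace ℝ E]
  {H : Type*} [TopologicalSpace H] (I : ModelWithCorners ℝ E H)
  {V : Type*} [TopologicalSpace V] [ChartedSpace H V]
  {EP : Type*} [NormedAddCommGroup EP] [NormedSpace ℝ EP]
  {HP : Type*} [TopologicalSpace HP] (IP : ModelWithCorners ℝ EP HP)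
  {P : Type*} [TopologicalSpace P] [ChartedSpace HP P]

/-- The principal circle bundle `π : P → V` has Euler class `u`. -/
def HasEulerClass [MulAction Circle P] (π : P → V) (u : CechH2 V) : Prop :=
  ∃ (U : V → Set V) (e : V → Bundle.Trivialization Circle π),
    IsPrincipalAtlas I (𝓡 1) IP U e ∧
    IsConnectingClass U (fun x y b => transitionFunction (e x) (e y) b) u

/-- The principal `S¹ × S¹`-bundle `π : P → V` has characteristic classes `(u₁, u₂)`: these are the
classes of the two components of its transition functions, i.e. the Euler classes of the two circle
bundles of which it is the fibre product. -/
def HasCharacteristicClasses [MulAction (Circle × Circle) P] (π : P → V) (u₁ u₂ : CechH2 V) :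
    Prop :=
  ∃ (U : V → Set V) (e : V → Bundle.Trivialization (Circle × Circle) π),
    IsPrincipalAtlas I ((𝓡 1).prod (𝓡 1)) IP U e ∧
    IsConnectingClass U (fun x y b => (transitionFunction (e x) (e y) b).1) u₁ ∧
    IsConnectingClass U (fun x y b => (transitionFunction (e x) (e y) b).2) u₂

end CharacteristicClasses

/-! ### Smooth maps to the circle -/

section SmoothCircle

variable {E : Type*} [NormedAddCommGroup E] [NormedSpace ℝ E]
  {H : Type*} [TopologicalSpace H] {I : ModelWithCorners ℝ E H}
  {M : Type*} [TopologicalSpace M] [ChartedSpace H M]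

/-! An integer matrix of determinant one acts on the fibre `S¹ × S¹` by an automorphism, and on the
pair of characteristic classes in the same way. Bézout supplies such a matrix taking `(q₁, q₂)` to
`(q₀, 0)` (`Int.exists_unimodular_gcd_zero`). After this change of fibre coordinates the torus
bundle has classes `(q₀a, 0)`, so it should be the fibre product of `P_{q₀}` with a trivial circle
bundle.

To make this explicit, let `g = (g₁, g₂)` and `g'` be the transition functions of the two bundles.
The circle cocycles `g₁^α g₂^β / g'` and `g₁^γ g₂^δ` have class zero, so by
`IsConnectingClass.exists_smooth_primitive` they are smooth coboundaries of families `f₁`, `f₂`. In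
local coordinates the diffeomorphism is `(b, t₁, t₂) ↦ (b, t₁^α t₂^β / f₁, t₁^γ t₂^δ / f₂)`; the
coboundary equations say exactly that these formulas agree on overlaps, and
`nonempty_diffeomorph_of_local` glues them. -/

theorem ContMDiffOn.zpow_of_lieGroup
    {EG : Type*} [NormedAddCommGroup EG] [NormedSpace ℝ EG]
    {HG : Type*} [TopologicalSpace HG] {IG : ModelWithCorners ℝ EG HG}
    {G : Type*} [TopologicalSpace G] [ChartedSpace HG G] [CommGroup G] {n : ℕ∞ω} [LieGroup IG n G]
    {f : M → G} {s : Set M} (hf : ContMDiffOn I IG n f s) (k : ℤ) :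
    ContMDiffOn I IG n (fun x => f x ^ k) s := by
  cases k with
  | ofNat k => simpa using hf.pow k
  | negSucc k => simpa using (hf.pow (k + 1)).inv

theorem Circle.contMDiff_coe {m : ℕ∞ω} :
    ContMDiff (𝓡 1) 𝓘(ℝ, ℂ) m (fun z : Circle => (z : ℂ)) := by
  have : Fact (Module.finrank ℝ ℂ = 1 + 1) := finrank_real_complex_fact'
  exact contMDiff_coe_sphere (E := ℂ) (n := 1)

theorem Circle.arg_contMDiffAt_one :
    ContMDiffAt (𝓡 1) 𝓘(ℝ, ℝ) ∞ (fun z : Circle => Complex.arg z) 1 := by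
  have h1 : ContDiffAt ℝ ∞ (fun z : ℂ => Complex.arg z) ((1 : Circle) : ℂ) := by
    have hlog : ContDiffAt ℝ ∞ Complex.log ((1 : Circle) : ℂ) :=
      (Complex.contDiffAt_log (by simp)).restrict_scalars ℝ
    have := Complex.imCLM.contDiff.contDiffAt.comp _ hlog
    exact this.congr_of_eventuallyEq (.of_forall fun z => by simp [Complex.log_im])
  exact h1.contMDiffAt.comp (1 : Circle) Circle.contMDiff_coe.contMDiffAt

/-- A continuous real-valued lift of a smooth circle-valued map is smooth. -/
theorem ContMDiffOn.of_circleExp_comp {g : M → Circle} {θ : M → ℝ} {s : Set M} (hs : IsOpen s)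
    (hg : ContMDiffOn I (𝓡 1) ∞ g s) (hθ : ContinuousOn θ s)
    (h : ∀ b ∈ s, g b = Circle.exp (θ b)) : ContMDiffOn I 𝓘(ℝ, ℝ) ∞ θ s := by
  intro b₀ hb₀
  refine ContMDiffAt.contMDiffWithinAt ?_
  have hgb : ContMDiffAt I (𝓡 1) ∞ (fun b => g b * (g b₀)⁻¹) b₀ :=
    (hg.contMDiffAt (hs.mem_nhds hb₀)).mul contMDiffAt_const
  have harg : ContMDiffAt I 𝓘(ℝ, ℝ) ∞ (fun b => Complex.arg (g b * (g b₀)⁻¹ : Circle)) b₀ := by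
    refine ContMDiffAt.comp (g := fun z : Circle => Complex.arg z) b₀ ?_ hgb
    simpa using Circle.arg_contMDiffAt_one
  have hsum : ContMDiffAt I 𝓘(ℝ, ℝ) ∞
      (fun b => Complex.arg (g b * (g b₀)⁻¹ : Circle) + θ b₀) b₀ := harg.add contMDiffAt_const
  refine hsum.congr_of_eventuallyEq ?_
  -- Within distance `π` of `θ b₀` no multiple of `2π` can intervene, so `arg` recovers `θ b - θ b₀`
  -- exactly.
  have hclose : ∀ᶠ b in nhds b₀, |θ b - θ b₀| < Real.pi := by
    have hc : ContinuousAt (fun b => |θ b - θ b₀|) b₀ :=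
      ((hθ.continuousAt (hs.mem_nhds hb₀)).sub continuousAt_const).abs
    exact hc.eventually (gt_mem_nhds (by simpa using Real.pi_pos))
  filter_upwards [hclose, hs.mem_nhds hb₀] with b hb hbs
  rw [h b hbs, h b₀ hb₀, ← Circle.exp_neg, ← Circle.exp_add, ← sub_eq_add_neg,
    Circle.arg_exp (neg_lt_of_abs_lt hb) (lt_of_abs_lt hb).le, sub_add_cancel]

theorem ContinuousOn.contMDiffOn_intCast {m : M → ℤ} {s : Set M} (hs : IsOpen s)
    (hm : ContinuousOn m s) {n : ℕ∞ω} : ContMDiffOn I 𝓘(ℝ, ℝ) n (fun b => (m b : ℝ)) s := by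
  intro b₀ hb₀
  refine ContMDiffAt.contMDiffWithinAt ?_
  refine (contMDiffAt_const (c := (m b₀ : ℝ))).congr_of_eventuallyEq ?_
  have : ∀ᶠ b in nhds b₀, m b ∈ ({m b₀} : Set ℤ) :=
    (hm.continuousAt (hs.mem_nhds hb₀)).eventually ((isOpen_discrete _).mem_nhds rfl)
  filter_upwards [this] with b hb
  rw [mem_singleton_iff.1 hb]

end SmoothCircle

/-! ### The connecting homomorphism -/

theorem IsConnectingClass.mul {V : Type*} [TopologicalSpace V] {U U' : V → Set V}
    {g g' : V → V → V → Circle} {u u' : CechH2 V} (h : IsConnectingClass U g u)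
    (h' : IsConnectingClass U' g' u') :
    IsConnectingClass (fun x => U x ∩ U' x) (fun x y b => g x y b * g' x y b) (u + u') := by
  obtain ⟨θ, c, hθ, hg, hc, rfl⟩ := h
  obtain ⟨θ', c', hθ', hg', hc', rfl⟩ := h'
  refine ⟨fun x y b => θ x y b + θ' x y b, c + c', fun x y => ?_, fun x y b hb => ?_,
    fun x y z b hb => ?_, rfl⟩
  · exact ((hθ x y).mono fun b hb => ⟨hb.1.1, hb.2.1⟩).add
      ((hθ' x y).mono fun b hb => ⟨hb.1.2, hb.2.2⟩)
  · simp only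
    rw [hg x y b ⟨hb.1.1, hb.2.1⟩, hg' x y b ⟨hb.1.2, hb.2.2⟩, mul_add, Circle.exp_add]
  · have h1 := hc x y z b ⟨⟨hb.1.1.1, hb.1.2.1⟩, hb.2.1⟩
    have h2 := hc' x y z b ⟨⟨hb.1.1.2, hb.1.2.2⟩, hb.2.2⟩
    simp only [AddSubgroup.coe_add, Pi.add_apply, Int.cast_add]
    linarith

theorem IsConnectingClass.zpow {V : Type*} [TopologicalSpace V] {U : V → Set V}
    {g : V → V → V → Circle} {u : CechH2 V} (h : IsConnectingClass U g u) (n : ℤ) :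
    IsConnectingClass U (fun x y b => g x y b ^ n) (n • u) := by
  obtain ⟨θ, c, hθ, hg, hc, rfl⟩ := h
  refine ⟨fun x y b => n * θ x y b, n • c, fun x y => continuousOn_const.mul (hθ x y),
    fun x y b hb => ?_, fun x y z b hb => ?_, rfl⟩
  · simp only
    rw [hg x y b hb, ← Circle.exp_zsmul]
    congr 1
    simp only [zsmul_eq_mul]
    ring
  · have h1 := hc x y z b hb
    simp only [AddSubgroup.coe_zsmul, Pi.smul_apply, smul_eq_mul, Int.cast_mul]
    rw [h1]
    ring

/-- A family of real-valued functions on the pairwise intersections of an open cover which satisfies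
the cocycle condition is a smooth coboundary. -/
theorem exists_smooth_primitive_of_real_cocycle
    {E : Type*} [NormedAddCommGroup E] [NormedSpace ℝ E] [FiniteDimensional ℝ E]
    {H : Type*} [TopologicalSpace H] (I : ModelWithCorners ℝ E H)
    {V : Type*} [TopologicalSpace V] [T2Space V] [SigmaCompactSpace V]
    [ChartedSpace H V] [IsManifold I ∞ V] {U : V → Set V} (hU : IsPointedCover U)
    {θ : V → V → V → ℝ} (hθ : ∀ x y, ContMDiffOn I 𝓘(ℝ, ℝ) ∞ (θ x y) (U x ∩ U y))
    (hc : ∀ x y z, ∀ b ∈ U x ∩ U y ∩ U z, θ x y b + θ y z b = θ x z b) :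
    ∃ φ : V → V → ℝ, (∀ x, ContMDiffOn I 𝓘(ℝ, ℝ) ∞ (φ x) (U x)) ∧
      ∀ x y, ∀ b ∈ U x ∩ U y, θ x y b = φ x b - φ y b := by
  obtain ⟨χ, hχ⟩ := SmoothPartitionOfUnity.exists_isSubordinate I isClosed_univ U
    (fun x => (hU x).1) (fun x _ => mem_iUnion.2 ⟨x, (hU x).2⟩)
  -- Averaging the cocycle over its second index with a partition of unity. Values of `θ x z`
  -- outside `U z` are harmless because `χ z` is supported in `U z`.
  refine ⟨fun x b => ∑ᶠ z, χ z b • θ x z b, fun x b hb => ?_, fun x y b hb => ?_⟩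
  · refine ContMDiffAt.contMDiffWithinAt (χ.contMDiffAt_finsum (n := ⊤) fun z hz => ?_)
    exact (hθ x z).contMDiffAt (((hU x).1.inter (hU z).1).mem_nhds ⟨hb, hχ z hz⟩)
  · have hfin : ∀ w, (Function.support fun z => χ z b • θ w z b).Finite := fun w =>
      (χ.locallyFinite.point_finite b).subset fun z hz => by
        simp only [Function.mem_support, smul_eq_mul, ne_eq, mul_eq_zero, not_or] at hz
        exact hz.1
    simp only
    rw [← finsum_sub_distrib (hfin x) (hfin y)]
    calc θ x y b = (∑ᶠ z, χ z b) * θ x y b := by rw [χ.sum_eq_one (mem_univ b), one_mul]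
      _ = ∑ᶠ z, χ z b * θ x y b := finsum_mul' _ _ (χ.locallyFinite.point_finite b)
      _ = _ := finsum_congr fun z => ?_
    by_cases hz : χ z b = 0
    · simp [hz]
    · have hbz : b ∈ U z := hχ z (subset_tsupport _ hz)
      rw [← hc x y z b ⟨hb, hbz⟩]
      simp only [smul_eq_mul]
      ring

/-- A smooth circle-valued cocycle with trivial class is a smooth coboundary on some finer cover. -/
theorem IsConnectingClass.exists_smooth_primitive
    {E : Type*} [NormedAddCommGroup E] [NormedSpace ℝ E] [FiniteDimensional ℝ E]
    {H : Type*} [TopologicalSpace H] {I : ModelWithCorners ℝ E H}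
    {V : Type*} [TopologicalSpace V] [T2Space V] [SigmaCompactSpace V]
    [ChartedSpace H V] [IsManifold I ∞ V] {U : V → Set V} (hU : IsPointedCover U)
    {g : V → V → V → Circle} (hg : ∀ x y, ContMDiffOn I (𝓡 1) ∞ (g x y) (U x ∩ U y))
    (h : IsConnectingClass U g 0) :
    ∃ (W : V → Set V) (f : V → V → Circle), IsPointedCover W ∧ (∀ x, W x ⊆ U x) ∧
      (∀ x, ContMDiffOn I (𝓡 1) ∞ (f x) (W x)) ∧
      ∀ x y, ∀ b ∈ W x ∩ W y, g x y b = f x b / f y b := by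
  obtain ⟨θ, c, hθ, hgθ, hcθ, hc⟩ := h
  have hc' : c.1 ∈ cechTwoCoboundaries V := by
    have := (QuotientAddGroup.eq_zero_iff c).1 hc.symm
    simpa [AddSubgroup.mem_addSubgroupOf] using this
  obtain ⟨U', hU', m, hm, hcm⟩ := hc'
  have hW := hU.inter hU'
  have hsmooth : ∀ x y, ContMDiffOn I 𝓘(ℝ, ℝ) ∞ (θ x y) (U x ∩ U y) := fun x y => by
    have ho := (hU x).1.inter (hU y).1
    have h1 : ContMDiffOn I 𝓘(ℝ, ℝ) ∞ (fun b => 2 * Real.pi * θ x y b) (U x ∩ U y) :=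
      (hg x y).of_circleExp_comp ho (continuousOn_const.mul (hθ x y)) (hgθ x y)
    have h2 : ContMDiffOn I 𝓘(ℝ, ℝ) ∞ (fun b => (2 * Real.pi)⁻¹ * (2 * Real.pi * θ x y b))
        (U x ∩ U y) := contMDiffOn_const.mul h1
    refine h2.congr fun b _ => ?_
    field_simp
  -- The integral cocycle is the coboundary of both `θ` and `m`, so `θ - m` is a genuine real
  -- cocycle; the integer correction `m` disappears on exponentiating.
  obtain ⟨φ, hφ, hφθ⟩ := exists_smooth_primitive_of_real_cocycle I hW
    (θ := fun x y b => θ x y b - m x y b)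
    (fun x y => ((hsmooth x y).mono fun b hb => ⟨hb.1.1, hb.2.1⟩).sub
      (((hm x y).contMDiffOn_intCast ((hU' x).1.inter (hU' y).1)).mono
        fun b hb => ⟨hb.1.2, hb.2.2⟩))
    (fun x y z b hb => by
      have h1 := hcθ x y z b ⟨⟨hb.1.1.1, hb.1.2.1⟩, hb.2.1⟩
      rw [hcm x y z b ⟨⟨hb.1.1.2, hb.1.2.2⟩, hb.2.2⟩] at h1
      push_cast at h1
      linarith)
  refine ⟨_, fun x b => Circle.exp (2 * Real.pi * φ x b), hW, fun x => inter_subset_left,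
    fun x => ?_, fun x y b hb => ?_⟩
  · exact contMDiff_circleExp.comp_contMDiffOn (contMDiffOn_const.mul (hφ x))
  · have h1 := hφθ x y b hb
    rw [hgθ x y b ⟨hb.1.1, hb.2.1⟩, ← Circle.exp_sub,
      show 2 * Real.pi * θ x y b = (2 * Real.pi * φ x b - 2 * Real.pi * φ y b)
        + 2 * Real.pi * m x y b by linear_combination 2 * Real.pi * h1,
      Circle.exp_add, Circle.exp_two_pi_mul_int, mul_one]

/-! ### Transition functions of principal bundles -/

section Transition

variable {E : Type*} [NormedAddCommGroup E] [NormedSpace ℝ E]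
  {H : Type*} [TopologicalSpace H] {I : ModelWithCorners ℝ E H}
  {V : Type*} [TopologicalSpace V] [ChartedSpace H V]
  {EG : Type*} [NormedAddCommGroup EG] [NormedSpace ℝ EG]
  {HG : Type*} [TopologicalSpace HG] {IG : ModelWithCorners ℝ EG HG}
  {G : Type*} [TopologicalSpace G] [ChartedSpace HG G] [CommGroup G]
  {EP : Type*} [NormedAddCommGroup EP] [NormedSpace ℝ EP]
  {HP : Type*} [TopologicalSpace HP] {IP : ModelWithCorners ℝ EP HP}
  {P : Type*} [TopologicalSpace P] [ChartedSpace HP P] [MulAction G P]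
  {π : P → V} {e e' : Bundle.Trivialization G π}

theorem IsPrincipalTrivialization.snd_eq_transitionFunction_mul
    (hπ : ∀ (g : G) (p : P), π (g • p) = π p) (he : IsPrincipalTrivialization I IG IP e)
    (he' : IsPrincipalTrivialization I IG IP e') {p : P} (hp : π p ∈ e.baseSet)
    (hp' : π p ∈ e'.baseSet) : (e p).2 = transitionFunction e e' (π p) * (e' p).2 := by
  -- The point of the fibre with `e'`-coordinate `1`; `p` is its translate by `(e' p).2`, and
  -- equivariance of `e` gives the formula.
  set s := e'.toOpenPartialHomeomorph.symm (π p, 1) with hs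
  have hπs : π s = π p := e'.proj_symm_apply' hp'
  have hps : (e' p).2 • s = p := by
    refine e'.toOpenPartialHomeomorph.injOn (e'.mem_source.2 (by rwa [hπ, hπs]))
      (e'.mem_source.2 hp') ?_
    change e' ((e' p).2 • s) = e' p
    rw [he'.map_smul _ _ (e'.mem_source.2 (by rwa [hπs])), hs, e'.apply_symm_apply' hp', mul_one,
      e'.mk_proj_snd' hp']
  have h := congrArg Prod.snd (he.map_smul (e' p).2 s (e.mem_source.2 (by rwa [hπs])))
  rw [hps] at h
  rw [h, mul_comm]
  rfl

theorem IsPrincipalTrivialization.contMDiffOn_transitionFunction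
    (he : IsPrincipalTrivialization I IG IP e) (he' : IsPrincipalTrivialization I IG IP e') :
    ContMDiffOn I IG ∞ (transitionFunction e e') (e.baseSet ∩ e'.baseSet) := by
  have h1 : ContMDiffOn I IP ∞ (fun b => e'.toOpenPartialHomeomorph.symm (b, (1 : G)))
      (e.baseSet ∩ e'.baseSet) :=
    he'.contMDiffOn_symm.comp (contMDiffOn_id.prodMk contMDiffOn_const)
      fun b hb => e'.mem_target.2 hb.2
  have h2 := he.contMDiffOn.comp h1 fun b hb =>
    e.mem_source.2 (by rw [e'.proj_symm_apply' hb.2]; exact hb.1)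
  exact contMDiff_snd.comp_contMDiffOn h2

end Transition

/-! ### Gluing diffeomorphisms over the base -/

/-- Fibre-preserving local diffeomorphisms over the members of an open cover of the base which agree
on the overlaps glue to a diffeomorphism. -/
theorem nonempty_diffeomorph_of_local
    {V : Type*} [TopologicalSpace V]
    {EM : Type*} [NormedAddCommGroup EM] [NormedSpace ℝ EM]
    {HM : Type*} [TopologicalSpace HM] {IM : ModelWithCorners ℝ EM HM}
    {M : Type*} [TopologicalSpace M] [ChartedSpace HM M]
    {EN : Type*} [NormedAddCommGroup EN] [NormedSpace ℝ EN]
    {HN : Type*} [TopologicalSpace HN] {IN : ModelWithCorners ℝ EN HN}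
    {N : Type*} [TopologicalSpace N] [ChartedSpace HN N]
    {π : M → V} {ρ : N → V} (hπ : Continuous π) (hρ : Continuous ρ)
    {U : V → Set V} (hU : IsPointedCover U) (φ : V → M → N) (ψ : V → N → M)
    (hφ : ∀ x, ContMDiffOn IM IN ∞ (φ x) (π ⁻¹' U x))
    (hψ : ∀ x, ContMDiffOn IN IM ∞ (ψ x) (ρ ⁻¹' U x))
    (hρφ : ∀ x, ∀ p ∈ π ⁻¹' U x, ρ (φ x p) = π p)
    (hπψ : ∀ x, ∀ p ∈ ρ ⁻¹' U x, π (ψ x p) = ρ p)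
    (hψφ : ∀ x, ∀ p ∈ π ⁻¹' U x, ψ x (φ x p) = p)
    (hφψ : ∀ x, ∀ p ∈ ρ ⁻¹' U x, φ x (ψ x p) = p)
    (hφφ : ∀ x y p, π p ∈ U x → π p ∈ U y → φ x p = φ y p) :
    Nonempty (Diffeomorph IM IN M N ∞) := by
  -- Compatibility of the inverses is automatic: apply the compatible maps `φ` to `ψ x p`.
  have hψψ : ∀ x y p, ρ p ∈ U x → ρ p ∈ U y → ψ x p = ψ y p := fun x y p hx hy => by
    have hx' : π (ψ x p) ∈ U x := by rwa [hπψ x p hx]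
    have hy' : π (ψ x p) ∈ U y := by rwa [hπψ x p hx]
    rw [← hψφ y (ψ x p) hy', ← hφφ x y _ hx' hy', hφψ x p hx]
  refine ⟨⟨⟨fun p => φ (π p) p, fun p => ψ (ρ p) p, fun p => ?_, fun p => ?_⟩, fun p => ?_,
    fun p => ?_⟩⟩
  · have hp := (hU (π p)).2
    simp only
    rw [hρφ (π p) p hp, hψφ (π p) p hp]
  · have hp := (hU (ρ p)).2
    simp only
    rw [hπψ (ρ p) p hp, hφψ (ρ p) p hp]
  · have hn : π ⁻¹' U (π p) ∈ nhds p := ((hU (π p)).1.preimage hπ).mem_nhds (hU (π p)).2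
    refine ((hφ (π p)).contMDiffAt hn).congr_of_eventuallyEq ?_
    filter_upwards [hn] with p' hp'
    exact hφφ _ _ _ (hU _).2 hp'
  · have hn : ρ ⁻¹' U (ρ p) ∈ nhds p := ((hU (ρ p)).1.preimage hρ).mem_nhds (hU (ρ p)).2
    refine ((hψ (ρ p)).contMDiffAt hn).congr_of_eventuallyEq ?_
    filter_upwards [hn] with p' hp'
    exact hψψ _ _ _ (hU _).2 hp'

/-! ### Automorphisms of the torus -/

theorem Int.exists_unimodular_gcd_zero (q₁ q₂ : ℤ) :
    ∃ α β γ δ : ℤ, α * δ - β * γ = 1 ∧ α * q₁ + β * q₂ = Int.gcd q₁ q₂ ∧ γ * q₁ + δ * q₂ = 0 := by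
  rcases eq_or_ne (Int.gcd q₁ q₂) 0 with h | h
  · obtain ⟨rfl, rfl⟩ := Int.gcd_eq_zero_iff.1 h
    exact ⟨1, 0, 0, 1, by simp⟩
  · have h0 : (Int.gcd q₁ q₂ : ℤ) ≠ 0 := by exact_mod_cast h
    obtain ⟨r₁, hr₁⟩ := Int.gcd_dvd_left q₁ q₂
    obtain ⟨r₂, hr₂⟩ := Int.gcd_dvd_right q₁ q₂
    have hb := Int.gcd_eq_gcd_ab q₁ q₂
    set d : ℤ := (Int.gcd q₁ q₂ : ℤ)
    -- The first row holds the Bézout coefficients, the second the cofactors `qᵢ = d rᵢ`. The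
    -- determinant is `1` after cancelling `d` in Bézout's identity.
    refine ⟨Int.gcdA q₁ q₂, Int.gcdB q₁ q₂, -r₂, r₁, ?_, by rw [hb]; ring, ?_⟩
    · apply mul_left_cancel₀ h0
      linear_combination (-1 : ℤ) * hb - Int.gcdA q₁ q₂ * hr₁ - Int.gcdB q₁ q₂ * hr₂
    · linear_combination (-r₂) * hr₁ + r₁ * hr₂

section TwoByTwo

variable {G : Type*} [CommGroup G] {α β γ δ : ℤ}

/-- The exponents `δ, -β` are the first row of the inverse matrix; the companion lemma uses the
second row `-γ, α`. -/
theorem zpow_unimodular_left (h : α * δ - β * γ = 1) (s t : G) :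
    (s ^ α * t ^ β) ^ δ * (s ^ γ * t ^ δ) ^ (-β) = s := by
  have h1 : α * δ + γ * (-β) = 1 := by linear_combination h
  rw [mul_zpow, mul_zpow, ← zpow_mul, ← zpow_mul, ← zpow_mul, ← zpow_mul, mul_mul_mul_comm,
    ← zpow_add, ← zpow_add, h1, show β * δ + δ * (-β) = 0 by ring, zpow_one, zpow_zero, mul_one]

theorem zpow_unimodular_right (h : α * δ - β * γ = 1) (s t : G) :
    (s ^ α * t ^ β) ^ (-γ) * (s ^ γ * t ^ δ) ^ α = t := by
  have h1 : β * (-γ) + δ * α = 1 := by linear_combination h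
  rw [mul_zpow, mul_zpow, ← zpow_mul, ← zpow_mul, ← zpow_mul, ← zpow_mul, mul_mul_mul_comm,
    ← zpow_add, ← zpow_add, h1, show α * (-γ) + γ * α = 0 by ring, zpow_one, zpow_zero, one_mul]

end TwoByTwo

theorem proposition2p1
    {E : Type*} [NormedAddCommGroup E] [NormedSpace ℝ E] [FiniteDimensional ℝ E]
    {V : Type*} [TopologicalSpace V] [T2Space V] [SigmaCompactSpace V]
    [ChartedSpace E V] [IsManifold 𝓘(ℝ, E) ∞ V]
    (a : CechH2 V) (q₁ q₂ : ℤ)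
    -- the principal torus bundle
    {EP : Type*} [NormedAddCommGroup EP] [NormedSpace ℝ EP] [FiniteDimensional ℝ EP]
    {HP : Type*} [TopologicalSpace HP] (IP : ModelWithCorners ℝ EP HP)
    {P : Type*} [TopologicalSpace P] [ChartedSpace HP P] [IsManifold IP ∞ P]
    [MulAction (Circle × Circle) P] (π : P → V)
    (hπ : IsSmoothPrincipalBundle 𝓘(ℝ, E) ((𝓡 1).prod (𝓡 1)) (Circle × Circle) IP π)
    (hP : HasCharacteristicClasses 𝓘(ℝ, E) IP π (q₁ • a) (q₂ • a))
    -- the principal circle bundle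
    {EQ : Type*} [NormedAddCommGroup EQ] [NormedSpace ℝ EQ] [FiniteDimensional ℝ EQ]
    {HQ : Type*} [TopologicalSpace HQ] (IQ : ModelWithCorners ℝ EQ HQ)
    {Q : Type*} [TopologicalSpace Q] [ChartedSpace HQ Q] [IsManifold IQ ∞ Q]
    [MulAction Circle Q] (ρ : Q → V)
    (hρ : IsSmoothPrincipalBundle 𝓘(ℝ, E) (𝓡 1) Circle IQ ρ)
    (hQ : HasEulerClass 𝓘(ℝ, E) IQ ρ ((Int.gcd q₁ q₂ : ℤ) • a)) :
    Nonempty (Diffeomorph IP (IQ.prod (𝓡 1)) P (Q × Circle) ∞) := by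

  obtain ⟨U, e, he, hu₁, hu₂⟩ := hP
  obtain ⟨U', e', he', hu'⟩ := hQ
  obtain ⟨α, β, γ, δ, hdet, hgcd, hzero⟩ := Int.exists_unimodular_gcd_zero q₁ q₂
  have hU := he.isPointedCover
  have hU' := he'.isPointedCover
  have hg : ∀ x y, ContMDiffOn 𝓘(ℝ, E) ((𝓡 1).prod (𝓡 1)) ∞ (transitionFunction (e x) (e y))
      (U x ∩ U y) := fun x y =>
    ((he.principal x).contMDiffOn_transitionFunction (he.principal y)).mono
      (inter_subset_inter (he.subset_baseSet x) (he.subset_baseSet y))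
  have hg' : ∀ x y, ContMDiffOn 𝓘(ℝ, E) (𝓡 1) ∞ (transitionFunction (e' x) (e' y))
      (U' x ∩ U' y) := fun x y =>
    ((he'.principal x).contMDiffOn_transitionFunction (he'.principal y)).mono
      (inter_subset_inter (he'.subset_baseSet x) (he'.subset_baseSet y))
  have hg₁ := fun x y => contMDiff_fst.comp_contMDiffOn (hg x y)
  have hg₂ := fun x y => contMDiff_snd.comp_contMDiffOn (hg x y)
  -- The class is `(αq₁ + βq₂ - q₀) • a = 0`; the exponent `-1` divides by the transition functions
  -- of `Q`.
  have hclass₁ := ((hu₁.zpow α).mul (hu₂.zpow β)).mul (hu'.zpow (-1))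
  rw [← mul_zsmul, ← mul_zsmul, ← mul_zsmul, ← add_zsmul, ← add_zsmul, hgcd, neg_one_mul,
    add_neg_cancel, zero_zsmul] at hclass₁
  have hclass₂ := (hu₁.zpow γ).mul (hu₂.zpow δ)
  rw [← mul_zsmul, ← mul_zsmul, ← add_zsmul, hzero, zero_zsmul] at hclass₂
  obtain ⟨W₁, f₁, hW₁, hWU₁, hf₁, hgf₁⟩ := hclass₁.exists_smooth_primitive (I := 𝓘(ℝ, E))
    ((hU.inter hU).inter hU') fun x y =>
      ((((hg₁ x y).zpow_of_lieGroup α).mul ((hg₂ x y).zpow_of_lieGroup β)).mono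
        fun b hb => ⟨hb.1.1.1, hb.2.1.1⟩).mul
      (((hg' x y).zpow_of_lieGroup (-1)).mono fun b hb => ⟨hb.1.2, hb.2.2⟩)
  obtain ⟨W₂, f₂, hW₂, hWU₂, hf₂, hgf₂⟩ := hclass₂.exists_smooth_primitive (I := 𝓘(ℝ, E))
    (hU.inter hU) fun x y =>
      ((((hg₁ x y).zpow_of_lieGroup γ).mul ((hg₂ x y).zpow_of_lieGroup δ)).mono
        fun b hb => ⟨hb.1.1, hb.2.1⟩)
  have hbase : ∀ x, W₁ x ∩ W₂ x ⊆ (e x).baseSet := fun x b hb =>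
    he.subset_baseSet x (hWU₁ x hb.1).1.1
  have hbase' : ∀ x, W₁ x ∩ W₂ x ⊆ (e' x).baseSet := fun x b hb =>
    he'.subset_baseSet x (hWU₁ x hb.1).2
  refine nonempty_diffeomorph_of_local (π := π) (ρ := fun n : Q × Circle => ρ n.1)
    hπ.contMDiff_proj.continuous (hρ.contMDiff_proj.continuous.comp continuous_fst) (hW₁.inter hW₂)
    (fun x p => ((e' x).toOpenPartialHomeomorph.symm
        (π p, (e x p).2.1 ^ α * (e x p).2.2 ^ β / f₁ x (π p)),
      (e x p).2.1 ^ γ * (e x p).2.2 ^ δ / f₂ x (π p)))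
    (fun x n => (e x).toOpenPartialHomeomorph.symm
      (ρ n.1, (((e' x n.1).2 * f₁ x (ρ n.1)) ^ δ * (n.2 * f₂ x (ρ n.1)) ^ (-β),
        ((e' x n.1).2 * f₁ x (ρ n.1)) ^ (-γ) * (n.2 * f₂ x (ρ n.1)) ^ α)))
    (fun x => ?_) (fun x => ?_) (fun x p hp => ?_) (fun x n hn => ?_) (fun x p hp => ?_)
    (fun x n hn => ?_) (fun x y p hx hy => ?_)
  · have ht : ContMDiffOn IP ((𝓡 1).prod (𝓡 1)) ∞ (fun p => (e x p).2)
        (π ⁻¹' (W₁ x ∩ W₂ x)) :=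
      contMDiff_snd.comp_contMDiffOn ((he.principal x).contMDiffOn.mono
        fun p hp => (e x).mem_source.2 (hbase x hp))
    have ht₁ := contMDiff_fst.comp_contMDiffOn ht
    have ht₂ := contMDiff_snd.comp_contMDiffOn ht
    have hF₁ : ContMDiffOn IP (𝓡 1) ∞ (fun p => f₁ x (π p)) (π ⁻¹' (W₁ x ∩ W₂ x)) :=
      (hf₁ x).comp hπ.contMDiff_proj.contMDiffOn fun p hp => hp.1
    have hF₂ : ContMDiffOn IP (𝓡 1) ∞ (fun p => f₂ x (π p)) (π ⁻¹' (W₁ x ∩ W₂ x)) :=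
      (hf₂ x).comp hπ.contMDiff_proj.contMDiffOn fun p hp => hp.2
    refine ContMDiffOn.prodMk ?_
      (((ht₁.zpow_of_lieGroup γ).mul (ht₂.zpow_of_lieGroup δ)).div hF₂)
    exact (he'.principal x).contMDiffOn_symm.comp (hπ.contMDiff_proj.contMDiffOn.prodMk
      (((ht₁.zpow_of_lieGroup α).mul (ht₂.zpow_of_lieGroup β)).div hF₁))
      fun p hp => (e' x).mem_target.2 (hbase' x hp)
  · have hρ₁ : ContMDiff (IQ.prod (𝓡 1)) 𝓘(ℝ, E) ∞ (fun n : Q × Circle => ρ n.1) :=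
      hρ.contMDiff_proj.comp contMDiff_fst
    have ht : ContMDiffOn (IQ.prod (𝓡 1)) (𝓡 1) ∞ (fun n : Q × Circle => (e' x n.1).2)
        ((fun n : Q × Circle => ρ n.1) ⁻¹' (W₁ x ∩ W₂ x)) :=
      contMDiff_snd.comp_contMDiffOn ((he'.principal x).contMDiffOn.comp contMDiff_fst.contMDiffOn
        fun n hn => (e' x).mem_source.2 (hbase' x hn))
    have hr₁ := ht.mul ((hf₁ x).comp hρ₁.contMDiffOn fun n hn => hn.1)
    have hr₂ := (contMDiff_snd (I := IQ) (J := 𝓡 1) (M := Q) (N := Circle)).contMDiffOn.mul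
      ((hf₂ x).comp (hρ₁.contMDiffOn (s := (fun n : Q × Circle => ρ n.1) ⁻¹' (W₁ x ∩ W₂ x)))
        fun n hn => hn.2)
    exact (he.principal x).contMDiffOn_symm.comp (hρ₁.contMDiffOn.prodMk
      (((hr₁.zpow_of_lieGroup δ).mul (hr₂.zpow_of_lieGroup (-β))).prodMk
        ((hr₁.zpow_of_lieGroup (-γ)).mul (hr₂.zpow_of_lieGroup α))))
      fun n hn => (e x).mem_target.2 (hbase x hn)
  · exact (e' x).proj_symm_apply' (hbase' x hp)
  · exact (e x).proj_symm_apply' (hbase x hn)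
  · simp only [(e' x).proj_symm_apply' (hbase' x hp), (e' x).apply_symm_apply' (hbase' x hp),
      div_mul_cancel, zpow_unimodular_left hdet, zpow_unimodular_right hdet]
    exact (e x).symm_apply_mk_proj ((e x).mem_source.2 (hbase x hp))
  · have hdet' : δ * α - (-β) * (-γ) = 1 := by linear_combination hdet
    have h₁ := zpow_unimodular_left hdet' ((e' x n.1).2 * f₁ x (ρ n.1)) (n.2 * f₂ x (ρ n.1))
    have h₂ := zpow_unimodular_right hdet' ((e' x n.1).2 * f₁ x (ρ n.1)) (n.2 * f₂ x (ρ n.1))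
    rw [neg_neg] at h₁ h₂
    simp only [(e x).proj_symm_apply' (hbase x hn), (e x).apply_symm_apply' (hbase x hn), h₁, h₂,
      mul_div_cancel_right]
    exact Prod.ext ((e' x).symm_apply_mk_proj ((e' x).mem_source.2 (hbase' x hn))) rfl
  · have ht := (he.principal x).snd_eq_transitionFunction_mul hπ.proj_smul (he.principal y)
      (hbase x hx) (hbase y hy)
    have h₁ : (transitionFunction (e x) (e y) (π p)).1 ^ α *
        (transitionFunction (e x) (e y) (π p)).2 ^ β *
        transitionFunction (e' x) (e' y) (π p) ^ (-1 : ℤ) = f₁ x (π p) / f₁ y (π p) :=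
      hgf₁ x y (π p) ⟨hx.1, hy.1⟩
    have h₂ : (transitionFunction (e x) (e y) (π p)).1 ^ γ *
        (transitionFunction (e x) (e y) (π p)).2 ^ δ = f₂ x (π p) / f₂ y (π p) :=
      hgf₂ x y (π p) ⟨hx.2, hy.2⟩
    rw [zpow_neg_one, ← div_eq_mul_inv, div_eq_div_iff_mul_eq_mul] at h₁
    rw [eq_div_iff_mul_eq'] at h₂
    set t := (e y p).2
    set g := transitionFunction (e x) (e y) (π p)
    refine Prod.ext ?_ ?_
    · simp only
      have hπy : ∀ r, ρ ((e' y).toOpenPartialHomeomorph.symm (π p, r)) = π p := fun r =>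
        (e' y).proj_symm_apply' (hbase' y hy)
      -- Rewriting a point of `Q` from chart `y` to chart `x` multiplies its coordinate by `g'`, so
      -- both sides can be compared in chart `x`.
      have hs : ∀ r, (e' y).toOpenPartialHomeomorph.symm (π p, r) =
          (e' x).toOpenPartialHomeomorph.symm
            (π p, transitionFunction (e' x) (e' y) (π p) * r) := fun r => by
        have h := (he'.principal x).snd_eq_transitionFunction_mul hρ.proj_smul (he'.principal y)
          (p := (e' y).toOpenPartialHomeomorph.symm (π p, r))
          (by rw [hπy]; exact hbase' x hx) (by rw [hπy]; exact hbase' y hy)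
        rw [hπy, (e' y).apply_symm_apply' (hbase' y hy)] at h
        rw [← h]
        nth_rewrite 2 [← hπy r]
        exact ((e' x).symm_apply_mk_proj
          ((e' x).mem_source.2 (by rw [hπy]; exact hbase' x hx))).symm
      rw [hs, ht]
      congr 2
      rw [Prod.fst_mul, Prod.snd_mul, mul_zpow, mul_zpow, mul_mul_mul_comm, mul_div_assoc',
        div_eq_div_iff_mul_eq_mul]
      calc _ = (g.1 ^ α * g.2 ^ β * f₁ y (π p)) * (t.1 ^ α * t.2 ^ β) := mul_right_comm _ _ _
        _ = _ := by rw [h₁, mul_assoc, mul_comm]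
    · simp only
      rw [ht, Prod.fst_mul, Prod.snd_mul, mul_zpow, mul_zpow, mul_mul_mul_comm,
        div_eq_div_iff_mul_eq_mul, mul_right_comm, h₂, mul_comm]
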